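/- Let $k=\mathbb R,\mathbb C$ or $\mathbb H$ and let $G=\{X\in M(n,k): X^*X=XX^*=I\}$ be the corresponding classical group $O(n)$, $U(n)$ or $Sp(n)$. Matrices act on columns $k^n$ from the left; subspaces of $k^n$ are right $k$-subspaces, and $\perp$ is taken for the standard Hermitian form. Let $A=\mathrm{diag}(a_1,\dots,a_n)$ with real $0<a_1<\dots<a_n$, and let $f_A(X)=\mathrm{Re}\,\mathrm{Tr}(AX)$ on $G$. Equip $G$ with the Riemannian metric induced by the scalar product $\tfrac12\mathrm{Re}\,\mathrm{Tr}(X^*Y)$ on $M(n,k)$, so that the gradient flow of $f_A$ is $\dot X=A-XAX$. For a critical point $X_0$ of $f_A$, let the open cell $C(X_0)$ (the interior of the cell that $f_A$ attaches to $X_0$) be the set of $X\in G$ such that the gradient trajectory $X(t)$, $t\in\mathbb R$, with $X(0)=X$ tends to $X_0$ as $t\to+\infty$. For $I\subseteq\{1,\dots,n\}$ with $|I|=m$, the Schubert cell $\sigma_I$ of the Grassmannian $G_{n,m}(k)$ is the set of the $m$-dimensional subspaces $W\subseteq k^n$ with $\dim(W\cap\langle e_1,\dots,e_j\rangle)=|I\cap\{1,\dots,j\}|$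 for $j=0,\dots,n$. For $X\in G$ put $V_-(X)=\{v\in k^n: Xv=-v\}$. Then: (1) different critical points of $f_A$ have different open cells; (2) the map $\sigma\mapsto\{X\in G: V_-(X)^{\perp}\in\sigma\}$ is a bijection from the set of all Schubert cells of all the Grassmannians $G_{n,m}(k)$, $m=0,\dots,n$, onto the set of the open cells of $f_A$ on $G$; in particular the open cell attached to a Schubert cell $\sigma$ consists of the operators $X\in G$ whose $(-1)$-eigenspace has its orthogonal complement in $\sigma$; (3) for every gradient trajectory $X(t)$ of $f_A$ in $G$ and every $t\in\mathbb R$, $V_-(X(t))=\exp(-At)\,V_-(X(0))$. -/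

import Mathlib

open Matrix Filter Topology
open scoped Quaternion

namespace HeightFlow

/-- The real part `Re : K → ℝ`, for the three classical division algebras `ℝ`, `ℂ`, `ℍ`
(the only instances are the three below). -/
class HasRealPart (K : Type) where
  re : K → ℝ

instance : HasRealPart ℝ := ⟨fun x => x⟩
instance : HasRealPart ℂ := ⟨fun z => z.re⟩
instance : HasRealPart ℍ[ℝ] := ⟨fun q => q.re⟩

section Flow

variable {K : Type} [DivisionRing K] [StarRing K] [TopologicalSpace K] [Algebra ℝ K]
  [ContinuousSMul ℝ K] [HasRealPart K] {n : ℕ}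

/-- The classical group `{X | X* X = X X* = 1}` of `n × n` matrices over `K`, as a subset of the
space of all matrices: `O(n)`, `U(n)`, `Sp(n)` for `K = ℝ`, `ℂ`, `ℍ`. -/
def classicalGroup (K : Type) [DivisionRing K] [StarRing K] (n : ℕ) :
    Set (Matrix (Fin n) (Fin n) K) :=
  (unitary (Matrix (Fin n) (Fin n) K) : Set (Matrix (Fin n) (Fin n) K))

/-- The Euclidean scalar product `(1/2) Re Tr (X* Y)` on matrices. It induces the Cartan-Killing
metric on the classical group, with the scale for which the gradient of `f_A` is exactly
`A* - X A X` (for `Re Tr (X* Y)` the gradient would be half of it, with the same orbits). -/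
noncomputable def matInner (X Y : Matrix (Fin n) (Fin n) K) : ℝ :=
  (1 / 2) * HasRealPart.re (Matrix.trace (Xᴴ * Y))

/-- The height function `f_A (X) = Re Tr (A X)`. -/
def height (A X : Matrix (Fin n) (Fin n) K) : ℝ :=
  HasRealPart.re (Matrix.trace (A * X))

/-- `c` is a curve in the classical group which is at `X` at time `0`, with velocity `Z`. -/
def IsCurveThrough (c : ℝ → Matrix (Fin n) (Fin n) K) (X Z : Matrix (Fin n) (Fin n) K) : Prop :=
  (∀ t, c t ∈ classicalGroup K n) ∧ c 0 = X ∧ HasDerivAt c Z 0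

/-- The tangent space of the classical group at `X`: all velocities of curves through `X`. -/
def tangentVectors (X : Matrix (Fin n) (Fin n) K) : Set (Matrix (Fin n) (Fin n) K) :=
  {Z | ∃ c, IsCurveThrough c X Z}

/-- `V` is the gradient at `X` of the restriction of `f_A` to the classical group, for the
Riemannian metric induced by the Euclidean scalar product of matrices: `V` is tangent at `X`, and
the derivative of `f_A` along each curve through `X` with velocity `Z` is the scalar product of
`V` and `Z`. -/
def IsGradientAt (A X V : Matrix (Fin n) (Fin n) K) : Prop :=
  V ∈ tangentVectors X ∧
    ∀ c Z, IsCurveThrough c X Z → HasDerivAt (fun t => height A (c t)) (matInner V Z) 0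

/-- The critical points of the restriction of `f_A` to the classical group. -/
def criticalPoints (A : Matrix (Fin n) (Fin n) K) : Set (Matrix (Fin n) (Fin n) K) :=
  {X | X ∈ classicalGroup K n ∧ IsGradientAt A X 0}

/-- A gradient trajectory: a solution, defined for all times, of `dX/dt = grad f_A (X)` in the
classical group. -/
def IsGradientTrajectory (A : Matrix (Fin n) (Fin n) K)
    (γ : ℝ → Matrix (Fin n) (Fin n) K) : Prop :=
  ∀ t, γ t ∈ classicalGroup K n ∧ ∃ V, IsGradientAt A (γ t) V ∧ HasDerivAt γ V t

/-- The open cell of the critical point `X₀`: the points whose gradient trajectory tends to `X₀`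
as `t → +∞`, that is, `X₀` and all the separatrices that join it to lower levels of `f_A`. -/
def openCell (A X₀ : Matrix (Fin n) (Fin n) K) : Set (Matrix (Fin n) (Fin n) K) :=
  {X | ∃ γ, IsGradientTrajectory A γ ∧ γ 0 = X ∧ Tendsto γ atTop (𝓝 X₀)}

/-- The set of the open cells that `f_A` determines on the classical group, one for each critical
point. -/
def openCells (A : Matrix (Fin n) (Fin n) K) : Set (Set (Matrix (Fin n) (Fin n) K)) :=
  openCell A '' criticalPoints A

end Flow

section Subspaces

variable {K : Type} [DivisionRing K] {n : ℕ}

/-- `K`-subspaces of the space of columns `Kⁿ`. Scalars act on the right, so that matrices act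
linearly from the left; for commutative `K` these are just the linear subspaces of `Kⁿ`. -/
abbrev Subspaces (K : Type) [DivisionRing K] (n : ℕ) : Type := Submodule Kᵐᵒᵖ (Fin n → K)

/-- The right linear map `v ↦ M v` of `Kⁿ`. -/
def mulVecRight (M : Matrix (Fin n) (Fin n) K) : (Fin n → K) →ₗ[Kᵐᵒᵖ] (Fin n → K) where
  toFun v := M *ᵥ v
  map_add' v w := Matrix.mulVec_add M v w
  map_smul' c v := Matrix.mulVec_smul M c v

/-- The eigenspace `{v | X v = -v}` of the eigenvalue `-1` (it is `0` if `-1` is not an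
eigenvalue). -/
def negEigenspace (X : Matrix (Fin n) (Fin n) K) : Subspaces K n :=
  LinearMap.eqLocus (mulVecRight X) (-LinearMap.id)

/-- The orthogonal complement for the standard Hermitian form `∑ i, w̄ᵢ vᵢ` on `Kⁿ`. -/
def orthCompl [StarRing K] (W : Subspaces K n) : Subspaces K n where
  carrier := {v | ∀ w ∈ W, star w ⬝ᵥ v = 0}
  add_mem' hu hv w hw := by rw [dotProduct_add, hu w hw, hv w hw, add_zero]
  zero_mem' w _ := dotProduct_zero _
  smul_mem' c v hv w hw := by rw [dotProduct_smul, hv w hw, smul_zero]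

/-- The member `F_k = span (e_1, …, e_k)` of the standard complete flag of `Kⁿ`. -/
def stdFlag (K : Type) [DivisionRing K] (n k : ℕ) : Subspaces K n where
  carrier := {v | ∀ i : Fin n, k ≤ (i : ℕ) → v i = 0}
  add_mem' hu hv i hi := by simp [hu i hi, hv i hi]
  zero_mem' _ _ := rfl
  smul_mem' c v hv i hi := by simp [hv i hi]

/-- The Grassmannian `G_{n,m}(K)` of `m`-dimensional subspaces of `Kⁿ`. -/
def grassmannian (K : Type) [DivisionRing K] (n m : ℕ) : Set (Subspaces K n) :=
  {W | Module.finrank Kᵐᵒᵖ W = m}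

/-- The Schubert cell of `G_{n,m}(K)`, `m = |I|`, with the jumps `I`: the subspaces `W` of
dimension `m` with `dim (W ∩ F_k) = |{i ∈ I | i ≤ k}|` for `k = 0, …, n`. Indices start at `0`
here, whence the strict inequality. -/
def schubertCell (K : Type) [DivisionRing K] {n : ℕ} (I : Finset (Fin n)) : Set (Subspaces K n) :=
  {W | W ∈ grassmannian K n I.card ∧
    ∀ k ≤ n, Module.finrank Kᵐᵒᵖ ↥(W ⊓ stdFlag K n k) = (I.filter fun i : Fin n => (i : ℕ) < k).card}

/-- The set of the Schubert cells of all the Grassmannians `G_{n,m}(K)`, `m = 0, …, n`. -/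
def schubertCells (K : Type) [DivisionRing K] (n : ℕ) : Set (Set (Subspaces K n)) :=
  {σ | ∃ m ≤ n, ∃ I : Finset (Fin n), I.card = m ∧ σ = schubertCell K I}

/-- The elements of the classical group whose `(-1)`-eigenspace has its orthogonal complement
in `σ`. -/
def operatorsOver [StarRing K] (σ : Set (Subspaces K n)) : Set (Matrix (Fin n) (Fin n) K) :=
  {X | X ∈ classicalGroup K n ∧ orthCompl (negEigenspace X) ∈ σ}

/-- The matrix `diag (a_1, …, a_n)` over `K` with real entries. -/
def realDiagonal (K : Type) [DivisionRing K] [Algebra ℝ K] {n : ℕ} (a : Fin n → ℝ) :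
    Matrix (Fin n) (Fin n) K :=
  Matrix.diagonal fun i => algebraMap ℝ K (a i)

end Subspaces

end HeightFlow

/-! The Riccati equation `X' = A - XAX` is linearised by a Cayley-type substitution. With `P =
exp(tA)(1 + X)` and `N = exp(-tA)(1 - X)`, the solution through `X` is `(P - N)(P + N)⁻¹`: since `P'
= AP` and `N' = -AN`, the sum and the difference satisfy `(P + N)' = A(P - N)` and `(P - N)' = A(P +
N)`. The sum stays invertible because `P*N` is skew-Hermitian, so `P + N` and `P - N` have the same
Gram matrix (`conjTranspose_mul_linear_parts`).

Everything is read off from this formula. A vector `(P + N)u` is a `(-1)`-eigenvector at time `t`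
iff `Pu = 0`, that is, iff `Xu = -u`; hence `V_-` moves by `exp(-tA)` (`negEigenspace_flow`).

For the limit, let `W` be the orthogonal complement of `V_-(X)`, which is the range of `1 + X`. If
some `w` in `W` has its last nonzero coordinate at `i`, the rescaled `exp(tA)w` tends to `e_i` and
the flow asymptotically fixes `e_i`. Otherwise, by duality, some `v` in `V_-(X)` has its first
nonzero coordinate at `i`; the rescaled `exp(-tA)v` tends to `e_i` and the flow asymptotically
negates it. So the limit is the diagonal sign matrix of the pivot set of `W` (`tendsto_flow`).
Schubert cells are the level sets of the pivot set (`mem_schubertCell_iff`) and the critical points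
are exactly the sign matrices, so both kinds of cells are indexed by the subsets `I`. -/

namespace HeightFlow

set_option linter.unusedSectionVars false

/-! ### Schubert cells as level sets of the pivot set -/

section Pivots

variable {K : Type} [DivisionRing K] {n : ℕ}

variable (K) in
/-- A division ring is a one-dimensional right vector space over itself. -/
def opLinearEquivSelf : K ≃ₗ[Kᵐᵒᵖ] Kᵐᵒᵖ where
  toFun := MulOpposite.op
  invFun := MulOpposite.unop
  map_add' _ _ := rfl
  map_smul' _ _ := rfl
  left_inv _ := rfl
  right_inv _ := rfl

variable (K) in
lemma finrank_op_self : Module.finrank Kᵐᵒᵖ K = 1 := by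
  rw [(opLinearEquivSelf K).finrank_eq, Module.finrank_self]

instance finiteDimensional_columns : FiniteDimensional Kᵐᵒᵖ (Fin n → K) :=
  have : Module.Finite Kᵐᵒᵖ K := Module.Finite.equiv (opLinearEquivSelf K).symm
  Module.Finite.pi

lemma single_mem_stdFlag {k : ℕ} {i : Fin n} (h : (i : ℕ) < k) (x : K) :
    Pi.single i x ∈ stdFlag K n k := fun j hj =>
  Pi.single_eq_of_ne (M := fun _ => K) (Fin.ne_of_val_ne (by omega : (j : ℕ) ≠ i)) x

open Classical in
/-- The positions of the last nonzero coordinates of the nonzero vectors of `W`. -/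
noncomputable def pivots (W : Subspaces K n) : Finset (Fin n) :=
  Finset.univ.filter fun i => ∃ w ∈ W, w i = 1 ∧ ∀ j, i < j → w j = 0

lemma mem_pivots {W : Subspaces K n} {i : Fin n} :
    i ∈ pivots W ↔ ∃ w ∈ W, w i = 1 ∧ ∀ j, i < j → w j = 0 := by
  simp [pivots]

lemma exists_normalized {W : Subspaces K n} {v : Fin n → K} (hv : v ∈ W) {i : Fin n}
    (hi : v i ≠ 0) : ∃ w ∈ W, w i = 1 ∧ ∀ j, v j = 0 → w j = 0 :=
  ⟨MulOpposite.op (v i)⁻¹ • v, W.smul_mem _ hv, mul_inv_cancel₀ hi, fun j hj => by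
    simp [hj]⟩

/-- Rank-nullity for the coordinate `k` on `W ⊓ F_{k+1}`: its kernel is `W ⊓ F_k`, and its range is
all of `K` or zero according to whether `k` is a pivot. -/
lemma finrank_inf_stdFlag_succ (W : Subspaces K n) (k : Fin n) :
    Module.finrank Kᵐᵒᵖ ↥(W ⊓ stdFlag K n (k + 1)) =
      Module.finrank Kᵐᵒᵖ ↥(W ⊓ stdFlag K n k) + if k ∈ pivots W then 1 else 0 := by
  set U := W ⊓ stdFlag K n (k + 1)
  let φ : U →ₗ[Kᵐᵒᵖ] K := (LinearMap.proj k).domRestrict U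
  have hφ : ∀ u : U, φ u = (u : Fin n → K) k := fun _ => rfl
  have hker : Module.finrank Kᵐᵒᵖ φ.ker = Module.finrank Kᵐᵒᵖ ↥(W ⊓ stdFlag K n k) := by
    rw [← Submodule.finrank_map_subtype_eq U φ.ker]
    suffices h : φ.ker.map U.subtype = W ⊓ stdFlag K n k by rw [h]
    ext v
    simp only [Submodule.mem_map, LinearMap.mem_ker, hφ, Submodule.mem_inf]
    constructor
    · rintro ⟨u, hu, rfl⟩
      refine ⟨u.2.1, fun i hi => ?_⟩
      obtain hi | hi := hi.lt_or_eq
      · exact u.2.2 i hi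
      · rwa [Fin.ext hi] at hu
    · rintro ⟨hW, hF⟩
      exact ⟨⟨v, hW, fun i hi => hF i (by omega)⟩, hF k le_rfl, rfl⟩
  have hrange : Module.finrank Kᵐᵒᵖ φ.range = if k ∈ pivots W then 1 else 0 := by
    split_ifs with hk
    · obtain ⟨w, hw, hwk, hwj⟩ := mem_pivots.1 hk
      have htop : φ.range = ⊤ := by
        have hwU : w ∈ U := ⟨hw, fun j hj => hwj j (Fin.lt_def.2 hj)⟩
        refine LinearMap.range_eq_top.2 fun x => ⟨MulOpposite.op x • ⟨w, hwU⟩, ?_⟩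
        rw [map_smul, show φ ⟨w, hwU⟩ = 1 from hwk]
        exact one_mul x
      rw [htop, finrank_top, finrank_op_self]
    · have hbot : φ.range = ⊥ := by
        refine LinearMap.range_eq_bot.2 (LinearMap.ext fun u => ?_)
        by_contra hu
        obtain ⟨w, hw, hwk, hwj⟩ := exists_normalized u.2.1 hu
        exact hk (mem_pivots.2 ⟨w, hw, hwk, fun j hj => hwj j (u.2.2 j hj)⟩)
      rw [hbot, finrank_bot]
  rw [← LinearMap.finrank_range_add_finrank_ker φ, hker, hrange, add_comm]

lemma card_filter_lt_succ (I : Finset (Fin n)) (k : Fin n) :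
    (I.filter fun i : Fin n => (i : ℕ) < k + 1).card =
      (I.filter fun i : Fin n => (i : ℕ) < k).card + if k ∈ I then 1 else 0 := by
  have h : (I.filter fun i : Fin n => (i : ℕ) < k + 1) =
      (I.filter fun i : Fin n => (i : ℕ) < k) ∪ I.filter fun i => i = k := by
    ext i
    simp only [Finset.mem_filter, Finset.mem_union, Fin.ext_iff, ← and_or_left,
      Nat.lt_succ_iff_lt_or_eq]
  rw [h, Finset.card_union_of_disjoint, Finset.filter_eq']
  · split_ifs <;> simp
  · refine Finset.disjoint_filter.2 fun i _ h1 h2 => ?_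
    subst h2
    exact lt_irrefl _ h1

lemma finrank_inf_stdFlag (W : Subspaces K n) {k : ℕ} (hk : k ≤ n) :
    Module.finrank Kᵐᵒᵖ ↥(W ⊓ stdFlag K n k) =
      ((pivots W).filter fun i : Fin n => (i : ℕ) < k).card := by
  induction k with
  | zero =>
    have h : W ⊓ stdFlag K n 0 = ⊥ := by
      rw [eq_bot_iff]
      exact fun v hv => funext fun i => hv.2 i (Nat.zero_le _)
    rw [h, finrank_bot]
    simp
  | succ k ih =>
    have h1 := finrank_inf_stdFlag_succ W ⟨k, hk⟩
    have h2 := card_filter_lt_succ (pivots W) ⟨k, hk⟩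
    simp only at h1 h2
    rw [h1, h2, ih (by omega)]

lemma finrank_eq_card_pivots (W : Subspaces K n) :
    Module.finrank Kᵐᵒᵖ W = (pivots W).card := by
  have h := finrank_inf_stdFlag W le_rfl
  have htop : stdFlag K n n = ⊤ := eq_top_iff.2 fun v _ i hi => absurd i.2 (by omega)
  rw [htop, inf_top_eq] at h
  rw [h, Finset.filter_true_of_mem fun i _ => i.2]

lemma mem_schubertCell_iff {W : Subspaces K n} {I : Finset (Fin n)} :
    W ∈ schubertCell K I ↔ pivots W = I := by
  constructor
  · rintro ⟨-, h⟩
    ext k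
    have h0 := h k k.2.le
    have h1 := h (k + 1) k.2
    -- The increments of the two dimension functions are the indicators of `pivots W` and of `I`.
    rw [finrank_inf_stdFlag_succ, card_filter_lt_succ, h0] at h1
    by_cases h2 : k ∈ pivots W <;> by_cases h3 : k ∈ I <;> simp_all
  · rintro rfl
    exact ⟨finrank_eq_card_pivots W, fun k hk => finrank_inf_stdFlag W hk⟩

lemma mem_negEigenspace {X : Matrix (Fin n) (Fin n) K} {v : Fin n → K} :
    v ∈ negEigenspace X ↔ X *ᵥ v = -v := Iff.rfl

lemma mem_orthCompl [StarRing K] {W : Subspaces K n} {v : Fin n → K} :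
    v ∈ orthCompl W ↔ ∀ w ∈ W, star w ⬝ᵥ v = 0 := Iff.rfl

end Pivots

-- The three division algebras and the real trace form

attribute [local instance] Matrix.linftyOpNormedRing Matrix.linftyOpNormedAlgebra

/-- A finite-dimensional normed division algebra over `ℝ` with an involution and a real part that
are compatible in the way they are for `ℝ`, `ℂ` and `ℍ`. -/
class ClassicalDivisionAlgebra (K : Type) [NormedDivisionRing K] [NormedAlgebra ℝ K] [StarRing K]
    [HasRealPart K] : Prop where
  finiteDimensional : FiniteDimensional ℝ K
  star_smul (r : ℝ) (x : K) : star (r • x) = r • star x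
  re_add (x y : K) : HasRealPart.re (x + y) = HasRealPart.re x + HasRealPart.re y
  re_smul (r : ℝ) (x : K) : HasRealPart.re (r • x) = r * HasRealPart.re x
  re_mul_comm (x y : K) : HasRealPart.re (x * y) = HasRealPart.re (y * x)
  re_star (x : K) : HasRealPart.re (star x) = HasRealPart.re x
  re_star_mul_self (x : K) : HasRealPart.re (star x * x) = ‖x‖ ^ 2

instance : ClassicalDivisionAlgebra ℝ where
  finiteDimensional := inferInstance
  star_smul r x := by simp
  re_add x y := rfl
  re_smul r x := rfl
  re_mul_comm x y := mul_comm x y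
  re_star x := congrArg _ (star_trivial x)
  re_star_mul_self x := by
    change x * x = ‖x‖ ^ 2
    rw [Real.norm_eq_abs, sq_abs, sq]

instance : ClassicalDivisionAlgebra ℂ where
  finiteDimensional := inferInstance
  star_smul r x := by simp
  re_add x y := rfl
  re_smul r x := Complex.re_ofReal_mul r x
  re_mul_comm x y := by rw [mul_comm]
  re_star x := rfl
  re_star_mul_self x := by
    change ((starRingEnd ℂ) x * x).re = ‖x‖ ^ 2
    rw [← Complex.normSq_eq_conj_mul_self, Complex.ofReal_re, Complex.normSq_eq_norm_sq]

instance : ClassicalDivisionAlgebra ℍ[ℝ] where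
  finiteDimensional := inferInstance
  star_smul r x := Quaternion.star_smul r x
  re_add x y := rfl
  re_smul r x := rfl
  re_mul_comm x y := by
    change (x * y).re = (y * x).re
    rw [Quaternion.re_mul, Quaternion.re_mul]
    ring
  re_star x := Quaternion.re_star x
  re_star_mul_self x := by
    change (star x * x).re = ‖x‖ ^ 2
    rw [Quaternion.star_mul_self, Quaternion.normSq_eq_norm_mul_self, Quaternion.re_coe, sq]

open ClassicalDivisionAlgebra

variable {K : Type} [NormedDivisionRing K] [NormedAlgebra ℝ K] [StarRing K] [HasRealPart K]
  [ClassicalDivisionAlgebra K] {n : ℕ}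

local notation "Mat" => Matrix (Fin n) (Fin n) K

variable (K) in
/-- The real part as a linear functional. -/
noncomputable def reLinear : K →ₗ[ℝ] ℝ where
  toFun := HasRealPart.re
  map_add' := re_add
  map_smul' := re_smul

lemma reLinear_apply (x : K) : reLinear K x = HasRealPart.re x := rfl

lemma finiteDimensional_matrix : FiniteDimensional ℝ Mat :=
  have := finiteDimensional (K := K)
  inferInstanceAs (FiniteDimensional ℝ (Fin n → Fin n → K))

/-- The real part of the trace, as a linear functional. -/
noncomputable def reTrace : Mat →ₗ[ℝ] ℝ := reLinear K ∘ₗ Matrix.traceLinearMap (Fin n) ℝ K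

lemma reTrace_mul_comm (X Y : Mat) : reTrace (X * Y) = reTrace (Y * X) := by
  simp only [reTrace, LinearMap.comp_apply, Matrix.traceLinearMap_apply, Matrix.trace,
    Matrix.diag_apply, Matrix.mul_apply, map_sum]
  rw [Finset.sum_comm]
  exact Finset.sum_congr rfl fun i _ => Finset.sum_congr rfl fun j _ => re_mul_comm _ _

lemma reTrace_conjTranspose (X : Mat) : reTrace Xᴴ = reTrace X := by
  simp only [reTrace, LinearMap.comp_apply, Matrix.traceLinearMap_apply, Matrix.trace,
    Matrix.diag_apply, Matrix.conjTranspose_apply, map_sum]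
  exact Finset.sum_congr rfl fun i _ => re_star _

lemma re_star_dotProduct_self (v : Fin n → K) :
    HasRealPart.re (star v ⬝ᵥ v) = ∑ i, ‖v i‖ ^ 2 := by
  rw [← reLinear_apply, dotProduct, map_sum]
  exact Finset.sum_congr rfl fun i _ => re_star_mul_self _

lemma eq_zero_of_re_star_dotProduct_self {v : Fin n → K}
    (h : HasRealPart.re (star v ⬝ᵥ v) = 0) : v = 0 := by
  rw [re_star_dotProduct_self, Finset.sum_eq_zero_iff_of_nonneg fun _ _ => sq_nonneg _] at h
  ext i
  simpa using h i (Finset.mem_univ i)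

lemma eq_zero_of_reTrace_conjTranspose_mul_self {D : Mat} (h : reTrace (Dᴴ * D) = 0) :
    D = 0 := by
  have h' : ∑ j, ∑ i, ‖D i j‖ ^ 2 = 0 := by
    rw [← h, reTrace, LinearMap.comp_apply, Matrix.traceLinearMap_apply, Matrix.trace, map_sum]
    exact Finset.sum_congr rfl fun j _ => (re_star_dotProduct_self fun i => D i j).symm
  rw [Finset.sum_eq_zero_iff_of_nonneg fun _ _ => Finset.sum_nonneg fun _ _ => sq_nonneg _] at h'
  ext i j
  have hj := h' j (Finset.mem_univ j)
  rw [Finset.sum_eq_zero_iff_of_nonneg fun _ _ => sq_nonneg _] at hj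
  simpa using hj i (Finset.mem_univ i)

lemma eq_zero_of_conjTranspose_mul_self {D : Mat} (h : Dᴴ * D = 0) : D = 0 :=
  eq_zero_of_reTrace_conjTranspose_mul_self (by rw [h, map_zero])

lemma matInner_eq (X Y : Mat) : matInner X Y = (1 / 2) * reTrace (Xᴴ * Y) := rfl

lemma conjTranspose_mul_of_mem {X : Mat} (hX : X ∈ classicalGroup K n) : Xᴴ * X = 1 := hX.1

lemma mul_conjTranspose_of_mem {X : Mat} (hX : X ∈ classicalGroup K n) : X * Xᴴ = 1 := hX.2

lemma mem_classicalGroup_of_conjTranspose_mul_self {X : Mat} (h : Xᴴ * X = 1) :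
    X ∈ classicalGroup K n := ⟨h, mul_eq_one_comm.1 h⟩

lemma hasDerivAt_linearMap_comp {F : Type} [NormedAddCommGroup F] [NormedSpace ℝ F]
    (L : Mat →ₗ[ℝ] F) {c : ℝ → Mat} {Z : Mat} {t : ℝ} (h : HasDerivAt c Z t) :
    HasDerivAt (fun s => L (c s)) (L Z) t := by
  have := finiteDimensional_matrix (K := K) (n := n)
  exact (LinearMap.toContinuousLinearMap L).hasFDerivAt.comp_hasDerivAt t h

variable (K n) in
/-- Conjugate transposition, as a real linear map. -/
noncomputable def conjTransposeLinear : Mat →ₗ[ℝ] Mat where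
  toFun := conjTranspose
  map_add' := conjTranspose_add
  map_smul' r X := by
    ext i j
    exact ClassicalDivisionAlgebra.star_smul r (X j i)

lemma HasDerivAt.conjTranspose {c : ℝ → Mat} {Z : Mat} {t : ℝ} (h : HasDerivAt c Z t) :
    HasDerivAt (fun s => (c s)ᴴ) Zᴴ t :=
  hasDerivAt_linearMap_comp (conjTransposeLinear K n) h

lemma hasDerivAt_height (A : Mat) {c : ℝ → Mat} {Z : Mat} {t : ℝ} (h : HasDerivAt c Z t) :
    HasDerivAt (fun s => height A (c s)) (reTrace (A * Z)) t :=
  hasDerivAt_linearMap_comp (reTrace ∘ₗ LinearMap.mulLeft ℝ A) h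

/-! ### Tangent vectors and the gradient formula -/

lemma conjTranspose_mul_add_eq_zero_of_mem_tangentVectors {X Z : Mat}
    (h : Z ∈ tangentVectors X) : Xᴴ * Z + Zᴴ * X = 0 := by
  obtain ⟨c, hc, hX, hd⟩ := h
  have h1 : HasDerivAt (fun t => (c t)ᴴ * c t) (Zᴴ * c 0 + (c 0)ᴴ * Z) 0 :=
    (HasDerivAt.conjTranspose hd).mul hd
  have h2 : (fun t => (c t)ᴴ * c t) = fun _ => (1 : Mat) := funext fun t => (hc t).1
  rw [h2] at h1
  have h3 := h1.unique (hasDerivAt_const (0 : ℝ) (1 : Mat))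
  rw [hX] at h3
  rw [add_comm, h3]

/-- For tangent `Z`, the term `XAX` contributes as much as `A` does, because `X*Z` is
skew-Hermitian. The resulting factor 2 cancels the `1/2` of the metric. -/
lemma matInner_gradient {A X Z : Mat} (hA : Aᴴ = A) (hX : X ∈ classicalGroup K n)
    (hZ : Xᴴ * Z + Zᴴ * X = 0) : matInner (A - X * A * X) Z = reTrace (A * Z) := by
  have h1 : reTrace (Xᴴ * A * Xᴴ * Z) = - reTrace (A * Z) := by
    rw [Matrix.mul_assoc, eq_neg_of_add_eq_zero_left hZ, Matrix.mul_neg, map_neg,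
      ← Matrix.mul_assoc, reTrace_mul_comm, ← Matrix.mul_assoc, ← Matrix.mul_assoc,
      mul_conjTranspose_of_mem hX,
      Matrix.one_mul, ← reTrace_conjTranspose]
    simp only [conjTranspose_mul, conjTranspose_conjTranspose, hA]
    rw [reTrace_mul_comm]
  rw [matInner_eq, conjTranspose_sub, conjTranspose_mul, conjTranspose_mul, hA,
    ← Matrix.mul_assoc, Matrix.sub_mul, map_sub, h1]
  ring

/-! ### The diagonal one-parameter group -/

lemma realDiagonal_conjTranspose (a : Fin n → ℝ) :
    (realDiagonal K a)ᴴ = realDiagonal K a := by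
  rw [realDiagonal, diagonal_conjTranspose]
  congr 1
  ext i
  simp only [Pi.star_apply, Algebra.algebraMap_eq_smul_one,
    ClassicalDivisionAlgebra.star_smul, star_one]

lemma realDiagonal_mul (a b : Fin n → ℝ) :
    realDiagonal K a * realDiagonal K b = realDiagonal K (a * b) := by
  simp [realDiagonal, diagonal_mul_diagonal]

lemma realDiagonal_mulVec (a : Fin n → ℝ) (v : Fin n → K) (i : Fin n) :
    (realDiagonal K a *ᵥ v) i = a i • v i := by
  rw [realDiagonal, mulVec_diagonal, Algebra.smul_def]

variable (K) in
/-- The one-parameter group `exp (t A)` of the diagonal matrix `A = diag (a₁, …, aₙ)`. -/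
noncomputable def expDiag (a : Fin n → ℝ) (t : ℝ) : Mat :=
  realDiagonal K fun i => Real.exp (t * a i)

lemma expDiag_zero (a : Fin n → ℝ) : expDiag K a 0 = 1 := by
  simp [expDiag, realDiagonal]

lemma expDiag_mul_neg (a : Fin n → ℝ) (t : ℝ) : expDiag K a t * expDiag K a (-t) = 1 := by
  rw [expDiag, expDiag, realDiagonal_mul]
  simp [realDiagonal, ← Real.exp_add]

lemma expDiag_neg_mul (a : Fin n → ℝ) (t : ℝ) : expDiag K a (-t) * expDiag K a t = 1 := by
  simpa using expDiag_mul_neg (K := K) a (-t)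

lemma hasDerivAt_realDiagonal {f : ℝ → Fin n → ℝ} {f' : Fin n → ℝ} {t : ℝ}
    (h : HasDerivAt f f' t) :
    HasDerivAt (fun s => realDiagonal K (f s)) (realDiagonal K f') t := by
  let L : (Fin n → ℝ) →ₗ[ℝ] Mat :=
    { toFun := realDiagonal K
      map_add' := fun x y => by simp [realDiagonal, diagonal_add]
      map_smul' := fun r x => by
        ext i j
        by_cases hij : i = j <;> simp [realDiagonal, hij, Algebra.smul_def] }
  exact (LinearMap.toContinuousLinearMap L).hasFDerivAt.comp_hasDerivAt t h

lemma hasDerivAt_expDiag (a : Fin n → ℝ) (t : ℝ) :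
    HasDerivAt (expDiag K a) (realDiagonal K a * expDiag K a t) t := by
  have h : HasDerivAt (fun (s : ℝ) (i : Fin n) => Real.exp (s * a i))
      (fun i => a i * Real.exp (t * a i)) t := by
    rw [hasDerivAt_pi]
    intro i
    have := ((hasDerivAt_id t).mul_const (a i)).exp
    simpa [mul_comm] using this
  rw [expDiag, realDiagonal_mul]
  exact hasDerivAt_realDiagonal h

/-! ### Linearisation and the explicit flow -/

/-- The growing part `exp (t A) (1 + X)` of the linearised flow. -/
noncomputable def growPart (a : Fin n → ℝ) (X : Mat) (t : ℝ) : Mat := expDiag K a t * (1 + X)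

/-- The decaying part `exp (-t A) (1 - X)` of the linearised flow. -/
noncomputable def decayPart (a : Fin n → ℝ) (X : Mat) (t : ℝ) : Mat := expDiag K a (-t) * (1 - X)

lemma hasDerivAt_growPart (a : Fin n → ℝ) (X : Mat) (t : ℝ) :
    HasDerivAt (growPart a X) (realDiagonal K a * growPart a X t) t := by
  rw [growPart, ← Matrix.mul_assoc]
  exact (hasDerivAt_expDiag a t).mul_const (1 + X)

lemma hasDerivAt_decayPart (a : Fin n → ℝ) (X : Mat) (t : ℝ) :
    HasDerivAt (decayPart a X) (-(realDiagonal K a * decayPart a X t)) t := by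
  have h : HasDerivAt (fun s => expDiag K a (-s)) (-(realDiagonal K a * expDiag K a (-t))) t := by
    have h0 := (hasDerivAt_expDiag (K := K) a (-t)).scomp t (hasDerivAt_neg t)
    rw [neg_one_smul] at h0
    exact h0
  rw [decayPart, ← Matrix.mul_assoc, ← Matrix.neg_mul]
  exact h.mul_const (1 - X)

lemma norm_apply_le_one {X : Mat} (hX : X ∈ classicalGroup K n) (i j : Fin n) : ‖X i j‖ ≤ 1 := by
  have h1 : (Xᴴ * X) j j = 1 := by
    rw [conjTranspose_mul_of_mem hX, Matrix.one_apply_eq]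
  have h2 : HasRealPart.re ((Xᴴ * X) j j) = ∑ i, ‖X i j‖ ^ 2 :=
    re_star_dotProduct_self fun i => X i j
  have h3 : HasRealPart.re (1 : K) = 1 := by
    simpa using re_star_mul_self (1 : K)
  rw [h1, h3] at h2
  have h4 := Finset.single_le_sum (f := fun i => ‖X i j‖ ^ 2) (fun _ _ => sq_nonneg _)
    (Finset.mem_univ i)
  rw [← h2] at h4
  exact (sq_le_one_iff₀ (norm_nonneg _)).1 h4

lemma norm_le_of_mem_classicalGroup {X : Mat} (hX : X ∈ classicalGroup K n) : ‖X‖ ≤ n := by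
  rw [Matrix.linfty_opNorm_def]
  have : (Finset.univ.sup fun i => ∑ j, ‖X i j‖₊) ≤ (n : NNReal) := by
    refine Finset.sup_le fun i _ => (Finset.sum_le_card_nsmul _ _ 1 fun j _ => ?_).trans ?_
    · exact norm_apply_le_one hX i j
    · simp
  exact_mod_cast this

/-- A solution of `X' = A - X A X` in the classical group satisfies the linearised equation. -/
lemma mul_growPart_add_decayPart (a : Fin n → ℝ) {γ : ℝ → Mat}
    (hγ : ∀ t, γ t ∈ classicalGroup K n)
    (hd : ∀ t, HasDerivAt γ (realDiagonal K a - γ t * realDiagonal K a * γ t) t) (t : ℝ) :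
    γ t * (growPart a (γ 0) t + decayPart a (γ 0) t) =
      growPart a (γ 0) t - decayPart a (γ 0) t := by
  set A := realDiagonal K a
  set P := growPart a (γ 0)
  set N := decayPart a (γ 0)
  -- The defect `D = (P - N) - γ(P + N)` solves the linear equation `D' = -γAD`. It vanishes at time
  -- 0, so uniqueness for this equation forces `D = 0`.
  have hD : ∀ t, HasDerivAt (fun s => (P s - N s) - γ s * (P s + N s))
      (-(γ t * A) * ((P t - N t) - γ t * (P t + N t))) t := by
    intro t
    have hP := hasDerivAt_growPart a (γ 0) t
    have hN := hasDerivAt_decayPart a (γ 0) t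
    refine ((hP.sub hN).sub ((hd t).mul (hP.add hN))).congr_deriv ?_
    simp only [Pi.add_apply]
    noncomm_ring
  -- The constant is uniform in `t` because the entries of a group element have norm at most 1,
  -- which bounds its row-sum norm by `n`.
  have hv : ∀ t, LipschitzOnWith ((n : NNReal) * ‖A‖₊) (fun D => -(γ t * A) * D) Set.univ := by
    intro t
    refine LipschitzWith.lipschitzOnWith (LipschitzWith.of_dist_le_mul fun D D' => ?_)
    rw [dist_eq_norm, dist_eq_norm, ← Matrix.mul_sub]
    refine (norm_mul_le _ _).trans (mul_le_mul_of_nonneg_right ?_ (norm_nonneg _))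
    rw [norm_neg]
    refine (norm_mul_le _ _).trans ?_
    rw [NNReal.coe_mul]
    exact mul_le_mul_of_nonneg_right (norm_le_of_mem_classicalGroup (hγ t)) (norm_nonneg _)
  have hz : ∀ t, HasDerivAt (fun _ : ℝ => (0 : Mat)) (-(γ t * A) * 0) t := by
    intro t
    rw [Matrix.mul_zero]
    exact hasDerivAt_const t 0
  have h0 : (P 0 - N 0) - γ 0 * (P 0 + N 0) = 0 := by
    simp only [P, N, growPart, decayPart, neg_zero, expDiag_zero, Matrix.one_mul]
    noncomm_ring
  have := congrFun (ODE_solution_unique_univ (t₀ := 0) hv (fun t => ⟨hD t, trivial⟩)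
    (fun t => ⟨hz t, trivial⟩) h0) t
  exact (sub_eq_zero.1 this).symm

/-- The two exponentials cancel in `P*N = (1 + X*)(1 - X) = X* - X`, so the cross terms `P*N` and
`N*P` add up to zero. This gives both the invertibility of `P + N` and the unitarity of the flow. -/
lemma conjTranspose_mul_linear_parts (a : Fin n → ℝ) {X : Mat} (hX : X ∈ classicalGroup K n)
    (t : ℝ) :
    (growPart a X t + decayPart a X t)ᴴ * (growPart a X t + decayPart a X t) =
      (growPart a X t - decayPart a X t)ᴴ * (growPart a X t - decayPart a X t) := by
  have hPN : (growPart a X t)ᴴ * decayPart a X t = Xᴴ - X := by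
    rw [growPart, decayPart, conjTranspose_mul, expDiag, realDiagonal_conjTranspose, ← expDiag,
      Matrix.mul_assoc, ← Matrix.mul_assoc (expDiag K a t), expDiag_mul_neg, Matrix.one_mul,
      conjTranspose_add, conjTranspose_one, Matrix.add_mul, Matrix.mul_sub, Matrix.mul_sub,
      conjTranspose_mul_of_mem hX]
    noncomm_ring
  have hNP : (decayPart a X t)ᴴ * growPart a X t = X - Xᴴ := by
    have := congrArg conjTranspose hPN
    rwa [conjTranspose_mul, conjTranspose_conjTranspose, conjTranspose_sub,
      conjTranspose_conjTranspose] at this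
  simp only [conjTranspose_add, conjTranspose_sub, Matrix.add_mul, Matrix.mul_add, Matrix.sub_mul,
    Matrix.mul_sub, hPN, hNP]
  abel

lemma isUnit_of_forall_mul_eq_zero {S : Mat} (h : ∀ U : Mat, S * U = 0 → U = 0) : IsUnit S := by
  have := finiteDimensional_matrix (K := K) (n := n)
  have hinj : Function.Injective (LinearMap.mulLeft ℝ S) :=
    (injective_iff_map_eq_zero _).2 h
  obtain ⟨U, hU⟩ := LinearMap.surjective_of_injective hinj 1
  exact IsUnit.of_mul_eq_one U hU

lemma isUnit_growPart_add_decayPart (a : Fin n → ℝ) {X : Mat} (hX : X ∈ classicalGroup K n)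
    (t : ℝ) : IsUnit (growPart a X t + decayPart a X t) := by
  refine isUnit_of_forall_mul_eq_zero fun U hU => ?_
  -- Equal Gram matrices have equal kernels. Hence `P` and `N` both kill `U`, and so do `1 + X` and
  -- `1 - X`, whose sum is 2.
  have hT : (growPart a X t - decayPart a X t) * U = 0 := by
    refine eq_zero_of_conjTranspose_mul_self ?_
    rw [conjTranspose_mul, Matrix.mul_assoc, ← Matrix.mul_assoc _ _ U,
      ← conjTranspose_mul_linear_parts a hX, Matrix.mul_assoc, hU, Matrix.mul_zero,
      Matrix.mul_zero]
  rw [Matrix.add_mul] at hU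
  rw [Matrix.sub_mul] at hT
  have h2 : (2 : ℝ) • (growPart a X t * U) = 0 := by
    rw [two_smul]
    calc _ = (growPart a X t * U + decayPart a X t * U) +
          (growPart a X t * U - decayPart a X t * U) := by abel
      _ = 0 := by rw [hU, hT, add_zero]
  have hP : growPart a X t * U = 0 := (smul_eq_zero.1 h2).resolve_left two_ne_zero
  have hN : decayPart a X t * U = 0 := by rwa [hP, zero_add] at hU
  have hP' : (1 + X) * U = 0 := by
    have := congrArg (expDiag K a (-t) * ·) hP
    simpa [growPart, ← Matrix.mul_assoc, expDiag_neg_mul] using this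
  have hN' : (1 - X) * U = 0 := by
    have := congrArg (expDiag K a t * ·) hN
    simpa [decayPart, ← Matrix.mul_assoc, expDiag_mul_neg] using this
  have h3 : (2 : ℝ) • U = 0 := by
    calc (2 : ℝ) • U = (1 + X) * U + (1 - X) * U := by rw [two_smul]; noncomm_ring
      _ = 0 := by rw [hP', hN', add_zero]
  exact (smul_eq_zero.1 h3).resolve_left two_ne_zero

/-- The solution of `X' = A - X A X` which starts at `X`. -/
noncomputable def flow (a : Fin n → ℝ) (X : Mat) (t : ℝ) : Mat :=
  (growPart a X t - decayPart a X t) * Ring.inverse (growPart a X t + decayPart a X t)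

lemma flow_mul (a : Fin n → ℝ) {X : Mat} (hX : X ∈ classicalGroup K n) (t : ℝ) :
    flow a X t * (growPart a X t + decayPart a X t) = growPart a X t - decayPart a X t := by
  rw [flow, Matrix.mul_assoc, Ring.inverse_mul_cancel _ (isUnit_growPart_add_decayPart a hX t),
    Matrix.mul_one]

lemma flow_zero (a : Fin n → ℝ) {X : Mat} (hX : X ∈ classicalGroup K n) : flow a X 0 = X := by
  have h := flow_mul a hX 0
  refine (isUnit_growPart_add_decayPart a hX 0).mul_right_cancel (h.trans ?_)
  simp only [growPart, decayPart, neg_zero, expDiag_zero, Matrix.one_mul]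
  noncomm_ring

lemma flow_mem (a : Fin n → ℝ) {X : Mat} (hX : X ∈ classicalGroup K n) (t : ℝ) :
    flow a X t ∈ classicalGroup K n := by
  refine mem_classicalGroup_of_conjTranspose_mul_self ?_
  have hS := isUnit_growPart_add_decayPart a hX t
  have hS' : IsUnit (growPart a X t + decayPart a X t)ᴴ := hS.star
  refine hS'.mul_left_cancel (hS.mul_right_cancel ?_)
  rw [Matrix.mul_one, conjTranspose_mul_linear_parts a hX, ← flow_mul a hX, conjTranspose_mul]
  simp only [Matrix.mul_assoc]

lemma hasDerivAt_flow (a : Fin n → ℝ) {X : Mat} (hX : X ∈ classicalGroup K n) (t : ℝ) :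
    HasDerivAt (flow a X)
      (realDiagonal K a - flow a X t * realDiagonal K a * flow a X t) t := by
  have := finiteDimensional_matrix (K := K) (n := n)
  have : CompleteSpace Mat := FiniteDimensional.complete ℝ _
  have hP := hasDerivAt_growPart a X t
  have hN := hasDerivAt_decayPart a X t
  obtain ⟨S, hS⟩ := isUnit_growPart_add_decayPart a hX t
  have hinv := hasFDerivAt_ringInverse (𝕜 := ℝ) S
  rw [hS] at hinv
  have h := (hP.sub hN).mul (hinv.comp_hasDerivAt t (hP.add hN))
  have hSi : Ring.inverse (growPart a X t + decayPart a X t) = (↑S⁻¹ : Mat) := by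
    rw [← hS, Ring.inverse_unit]
  have hSS : (growPart a X t + decayPart a X t) * (↑S⁻¹ : Mat) = 1 := by rw [← hS, S.mul_inv]
  refine (h.congr_deriv ?_ :)
  simp only [flow, Function.comp_apply, hSi, _root_.neg_apply,
    ContinuousLinearMap.mulLeftRight_apply, Pi.add_apply, Pi.sub_apply]
  set P := growPart a X t
  set N := decayPart a X t
  set A := realDiagonal K a
  calc _ = A * ((P + N) * (↑S⁻¹ : Mat)) - (P - N) * ↑S⁻¹ * A * ((P - N) * ↑S⁻¹) := by
        noncomm_ring
    _ = _ := by rw [hSS, Matrix.mul_one]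

lemma isCurveThrough_flow (a : Fin n → ℝ) {X : Mat} (hX : X ∈ classicalGroup K n) :
    IsCurveThrough (flow a X) X (realDiagonal K a - X * realDiagonal K a * X) := by
  refine ⟨flow_mem a hX, flow_zero a hX, ?_⟩
  have := hasDerivAt_flow a hX 0
  rwa [flow_zero a hX] at this

/-- The explicit flow supplies a curve with velocity `A - XAX`, which shows that this vector is
tangent. -/
lemma isGradientAt_iff (a : Fin n → ℝ) {X V : Mat} (hX : X ∈ classicalGroup K n) :
    IsGradientAt (realDiagonal K a) X V ↔ V = realDiagonal K a - X * realDiagonal K a * X := by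
  have hA := realDiagonal_conjTranspose (K := K) a
  constructor
  · rintro ⟨hV, hgrad⟩
    set V₀ := realDiagonal K a - X * realDiagonal K a * X with hV₀
    have hin : ∀ Z ∈ tangentVectors X, matInner V Z = matInner V₀ Z := by
      intro Z hZ
      have hZ' := conjTranspose_mul_add_eq_zero_of_mem_tangentVectors hZ
      obtain ⟨c, hc⟩ := hZ
      rw [matInner_gradient hA hX hZ']
      exact (hgrad c Z hc).unique (hasDerivAt_height _ hc.2.2)
    -- Both `V` and `V₀` are tangent, so `V - V₀` may be tested against each of them; it is
    -- orthogonal to itself.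
    have h1 := hin V hV
    have h2 := hin V₀ ⟨_, isCurveThrough_flow a hX⟩
    simp only [matInner_eq] at h1 h2
    refine sub_eq_zero.1 (eq_zero_of_reTrace_conjTranspose_mul_self ?_)
    simp only [conjTranspose_sub, Matrix.sub_mul, Matrix.mul_sub, map_sub]
    linarith
  · rintro rfl
    refine ⟨⟨_, isCurveThrough_flow a hX⟩, fun c Z hc => ?_⟩
    rw [matInner_gradient hA hX
      (conjTranspose_mul_add_eq_zero_of_mem_tangentVectors ⟨c, hc⟩)]
    exact hasDerivAt_height _ hc.2.2

lemma isGradientTrajectory_flow (a : Fin n → ℝ) {X : Mat} (hX : X ∈ classicalGroup K n) :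
    IsGradientTrajectory (realDiagonal K a) (flow a X) := fun t =>
  ⟨flow_mem a hX t, _, (isGradientAt_iff a (flow_mem a hX t)).2 rfl, hasDerivAt_flow a hX t⟩

lemma IsGradientTrajectory.eq_flow {a : Fin n → ℝ} {γ : ℝ → Mat}
    (h : IsGradientTrajectory (realDiagonal K a) γ) : γ = flow a (γ 0) := by
  ext1 t
  have hd : ∀ t, HasDerivAt γ (realDiagonal K a - γ t * realDiagonal K a * γ t) t := by
    intro t
    obtain ⟨hm, V, hV, hd⟩ := h t
    rwa [(isGradientAt_iff a hm).1 hV] at hd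
  refine (isUnit_growPart_add_decayPart a (h 0).1 t).mul_right_cancel ?_
  rw [flow_mul a (h 0).1, mul_growPart_add_decayPart a (fun t => (h t).1) hd]

lemma mem_openCell_iff (a : Fin n → ℝ) {X X₀ : Mat} :
    X ∈ openCell (realDiagonal K a) X₀ ↔
      X ∈ classicalGroup K n ∧ Tendsto (flow a X) atTop (𝓝 X₀) := by
  constructor
  · rintro ⟨γ, hγ, rfl, ht⟩
    exact ⟨(hγ 0).1, hγ.eq_flow ▸ ht⟩
  · rintro ⟨hX, ht⟩
    exact ⟨_, isGradientTrajectory_flow a hX, flow_zero a hX, ht⟩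

variable (K n) in
/-- The real part of the standard Hermitian form, as a real bilinear form. -/
noncomputable def realForm : LinearMap.BilinForm ℝ (Fin n → K) :=
  LinearMap.mk₂ ℝ (fun u v => reLinear K (star u ⬝ᵥ v))
    (fun u u' v => by rw [star_add, add_dotProduct, map_add])
    (fun r u v => by
      have h : star (r • u) = r • star u :=
        funext fun i => ClassicalDivisionAlgebra.star_smul r (u i)
      rw [h, smul_dotProduct, map_smul])
    (fun u v v' => by rw [dotProduct_add, map_add])
    (fun r u v => by rw [dotProduct_smul, map_smul])

lemma realForm_apply (u v : Fin n → K) : realForm K n u v = HasRealPart.re (star u ⬝ᵥ v) := rfl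

lemma realForm_comm (u v : Fin n → K) : realForm K n u v = realForm K n v u := by
  rw [realForm_apply, realForm_apply, ← re_star, star_dotProduct, star_star]

lemma realForm_nondegenerate : (realForm K n).Nondegenerate := by
  have h : ∀ u : Fin n → K, (∀ v, realForm K n u v = 0) → u = 0 := fun u hu =>
    eq_zero_of_re_star_dotProduct_self (hu u)
  exact ⟨h, fun v hv => h v fun u => by rw [realForm_comm, hv]⟩

lemma restrictScalars_orthCompl (W : Subspaces K n) :
    (orthCompl W).restrictScalars ℝ = (realForm K n).orthogonal (W.restrictScalars ℝ) := by
  ext v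
  rw [Submodule.restrictScalars_mem, LinearMap.BilinForm.mem_orthogonal_iff]
  constructor
  · intro h w hw
    rw [realForm_apply, h w hw, ← reLinear_apply, map_zero]
  · intro h w hw
    -- Replacing `w` by its right multiple by `⟨w, v⟩` turns the real part of the form into `‖⟨w,
    -- v⟩‖²`, so real orthogonality to a `K`-subspace implies Hermitian orthogonality.
    have h1 := h _ (W.smul_mem (MulOpposite.op (star w ⬝ᵥ v)) hw)
    have h2 : star (MulOpposite.op (star w ⬝ᵥ v) • w) ⬝ᵥ v =
        star (star w ⬝ᵥ v) * (star w ⬝ᵥ v) := by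
      conv_rhs => rw [dotProduct, Finset.mul_sum]
      rw [dotProduct]
      refine Finset.sum_congr rfl fun i _ => ?_
      rw [← mul_assoc]
      exact congrArg (· * v i) (star_mul (w i) _)
    rw [realForm_apply, h2, re_star_mul_self] at h1
    simpa using h1

lemma orthCompl_orthCompl (W : Subspaces K n) : orthCompl (orthCompl W) = W := by
  have := finiteDimensional (K := K)
  refine Submodule.restrictScalars_injective ℝ Kᵐᵒᵖ _ ?_
  rw [restrictScalars_orthCompl, restrictScalars_orthCompl]
  refine LinearMap.BilinForm.orthogonal_orthogonal realForm_nondegenerate ?_ _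
  intro u v h
  rwa [realForm_comm]

/-- If no vector of `W` ends at the coordinate `i`, then some vector of the orthogonal complement
starts there. -/
lemma exists_mem_orthCompl_of_notMem_pivots {W : Subspaces K n} {i : Fin n} (hi : i ∉ pivots W) :
    ∃ v ∈ orthCompl W, v i = 1 ∧ ∀ j, j < i → v j = 0 := by
  by_contra! hcon
  refine hi (mem_pivots.2 ?_)
  -- By double orthogonality it suffices that every `v` orthogonal to `W` and to `e_j`, `j < i`, has
  -- `v i = 0`; otherwise a normalised `v` would contradict `hcon`. The `W`-part of `e_i` then ends
  -- at `i`.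
  have hmem : Pi.single i 1 ∈ W ⊔ stdFlag K n i := by
    rw [← orthCompl_orthCompl (W ⊔ stdFlag K n i)]
    intro v hv
    rw [dotProduct_single_one, Pi.star_apply, star_eq_zero]
    by_contra hvi
    obtain ⟨w, hw, hwi, hwj⟩ := exists_normalized hv hvi
    obtain ⟨j, hj, hne⟩ := hcon w (fun u hu => hw u (Submodule.mem_sup_left hu)) hwi
    refine hne (hwj j ?_)
    have h1 := hv _ (Submodule.mem_sup_right (single_mem_stdFlag (K := K) hj 1))
    simpa [← Pi.single_star] using h1
  obtain ⟨w, hw, f, hf, hwf⟩ := Submodule.mem_sup.1 hmem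
  refine ⟨w, hw, ?_, fun j hj => ?_⟩
  · simpa [hf i le_rfl] using congrFun hwf i
  · simpa [hf j (Fin.lt_def.1 hj).le, hj.ne'] using congrFun hwf j

lemma mulVec_eq_neg_iff_conjTranspose {X : Matrix (Fin n) (Fin n) K}
    (hX : X ∈ classicalGroup K n) {v : Fin n → K} : Xᴴ *ᵥ v = -v ↔ X *ᵥ v = -v := by
  constructor <;> intro h
  · have := congrArg (X *ᵥ ·) h
    simp only [mulVec_mulVec, mul_conjTranspose_of_mem hX, one_mulVec, mulVec_neg] at this
    rw [eq_comm, neg_eq_iff_eq_neg] at this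
    exact this
  · have := congrArg (Xᴴ *ᵥ ·) h
    simp only [mulVec_mulVec, conjTranspose_mul_of_mem hX, one_mulVec, mulVec_neg] at this
    rw [eq_comm, neg_eq_iff_eq_neg] at this
    exact this

/-- The complement of the range of `1 + X` is the kernel of `1 + X*`, which for unitary `X` is also
the kernel of `1 + X`. -/
lemma orthCompl_negEigenspace {X : Matrix (Fin n) (Fin n) K} (hX : X ∈ classicalGroup K n) :
    orthCompl (negEigenspace X) = LinearMap.range (mulVecRight (1 + X)) := by
  rw [← orthCompl_orthCompl (LinearMap.range (mulVecRight (1 + X)))]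
  congr 1
  ext v
  rw [mem_negEigenspace, ← mulVec_eq_neg_iff_conjTranspose hX, mem_orthCompl]
  have hadj : ∀ u, star (mulVecRight (1 + X) u) ⬝ᵥ v = star u ⬝ᵥ (v + Xᴴ *ᵥ v) := by
    intro u
    change star ((1 + X) *ᵥ u) ⬝ᵥ v = _
    rw [star_mulVec, ← dotProduct_mulVec, conjTranspose_add, conjTranspose_one, add_mulVec,
      one_mulVec]
  constructor
  · rintro h _ ⟨u, rfl⟩
    rw [hadj, h, add_neg_cancel, dotProduct_zero]
  · intro h
    have h0 : v + Xᴴ *ᵥ v = 0 := by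
      refine eq_zero_of_re_star_dotProduct_self ?_
      rw [← hadj, h _ ⟨_, rfl⟩, ← reLinear_apply, map_zero]
    exact eq_neg_of_add_eq_zero_right h0

/-! ### Critical points -/

variable (K) in
/-- The diagonal matrix with entries `1` at the positions in `I` and `-1` elsewhere. -/
noncomputable def signDiag (I : Finset (Fin n)) : Mat :=
  realDiagonal K fun i => if i ∈ I then 1 else -1

lemma signDiag_mul_self (I : Finset (Fin n)) : signDiag K I * signDiag K I = 1 := by
  rw [signDiag, realDiagonal_mul]
  have h : ((fun i => if i ∈ I then 1 else -1) * fun i => if i ∈ I then 1 else -1 :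
      Fin n → ℝ) = 1 := by
    ext i
    by_cases hi : i ∈ I <;> simp [hi]
  rw [h]
  simp [realDiagonal]

lemma signDiag_mem (I : Finset (Fin n)) : signDiag K I ∈ classicalGroup K n := by
  refine mem_classicalGroup_of_conjTranspose_mul_self ?_
  rw [signDiag, realDiagonal_conjTranspose]
  exact signDiag_mul_self I

lemma signDiag_mem_criticalPoints (a : Fin n → ℝ) (I : Finset (Fin n)) :
    signDiag K I ∈ criticalPoints (realDiagonal K a) := by
  refine ⟨signDiag_mem I, (isGradientAt_iff a (signDiag_mem I)).2 ?_⟩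
  have hcomm : signDiag K I * realDiagonal K a = realDiagonal K a * signDiag K I := by
    rw [signDiag, realDiagonal_mul, realDiagonal_mul, mul_comm]
  rw [hcomm, Matrix.mul_assoc, signDiag_mul_self, Matrix.mul_one, sub_self]

/-- From `A = XAX` follow `X*A = AX` and `XA = AX*`, so `X` commutes with `A²`. Its eigenvalues
`a_i²` are distinct because the `a_i` are positive and distinct, hence `X` is diagonal, and its
entries square to 1. -/
lemma eq_signDiag_of_mem_criticalPoints {a : Fin n → ℝ} (ha_pos : ∀ i, 0 < a i)
    (ha : Function.Injective a) {X : Mat} (h : X ∈ criticalPoints (realDiagonal K a)) :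
    ∃ I, X = signDiag K I := by
  classical
  obtain ⟨hX, hgrad⟩ := h
  have hXAX : realDiagonal K a = X * realDiagonal K a * X :=
    sub_eq_zero.1 ((isGradientAt_iff a hX).1 hgrad).symm
  have h1 : Xᴴ * realDiagonal K a = realDiagonal K a * X := by
    conv_lhs => rw [hXAX]
    rw [← Matrix.mul_assoc, ← Matrix.mul_assoc, conjTranspose_mul_of_mem hX, Matrix.one_mul]
  have h2 : X * realDiagonal K a = realDiagonal K a * Xᴴ := by
    conv_rhs => rw [hXAX]
    rw [Matrix.mul_assoc, mul_conjTranspose_of_mem hX, Matrix.mul_one]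
  have hsq : X * realDiagonal K (a * a) = realDiagonal K (a * a) * X := by
    rw [← realDiagonal_mul, ← Matrix.mul_assoc, h2, Matrix.mul_assoc, h1, Matrix.mul_assoc]
  have hoff : ∀ i j, i ≠ j → X i j = 0 := by
    intro i j hij
    have hentry := congrFun (congrFun hsq i) j
    rw [realDiagonal, mul_diagonal, diagonal_mul, ← Algebra.commutes, ← Algebra.smul_def,
      ← Algebra.smul_def, ← sub_eq_zero, ← sub_smul] at hentry
    refine (smul_eq_zero.1 hentry).resolve_left fun hzero => hij (ha ?_)
    rw [Pi.mul_apply, Pi.mul_apply, sub_eq_zero] at hzero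
    exact (mul_self_inj_of_nonneg (ha_pos j).le (ha_pos i).le).1 hzero |>.symm
  have hdiag : X = diagonal fun i => X i i := by
    ext i j
    by_cases hij : i = j
    · subst hij
      simp
    · rw [diagonal_apply_ne _ hij, hoff i j hij]
  have hone : ∀ i, X i i = 1 ∨ X i i = -1 := by
    intro i
    have hentry : algebraMap ℝ K (a i) = X i i * algebraMap ℝ K (a i) * X i i := by
      have := congrFun (congrFun hXAX i) i
      rw [hdiag] at this
      simpa [realDiagonal] using this
    rw [← Algebra.commutes, mul_assoc] at hentry
    have hne : algebraMap ℝ K (a i) ≠ 0 :=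
      (map_ne_zero_iff _ (algebraMap ℝ K).injective).2 (ha_pos i).ne'
    have hsq1 : X i i * X i i = 1 := by
      refine mul_left_cancel₀ hne ?_
      rw [mul_one, ← hentry]
    exact mul_self_eq_one_iff.1 hsq1
  refine ⟨Finset.univ.filter fun i => X i i = 1, ?_⟩
  rw [signDiag, realDiagonal]
  conv_lhs => rw [hdiag]
  congr 1
  ext i
  by_cases hi : X i i = 1
  · simp [hi]
  · simp only [Finset.mem_filter_univ, hi, if_false, map_neg, map_one]
    exact (hone i).resolve_left hi

/-! ### Eigenspaces along the flow and limits of trajectories -/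

lemma tendsto_exp_smul_expDiag_mulVec {b : Fin n → ℝ} {c : ℝ} {v l : Fin n → K}
    (h : ∀ j, (b j = c ∧ l j = v j) ∨ (b j < c ∧ l j = 0) ∨ (v j = 0 ∧ l j = 0)) :
    Tendsto (fun t : ℝ => Real.exp (t * -c) • (expDiag K b t *ᵥ v)) atTop (𝓝 l) := by
  rw [tendsto_pi_nhds]
  intro j
  have hj : ∀ t : ℝ, (Real.exp (t * -c) • (expDiag K b t *ᵥ v)) j =
      Real.exp ((b j - c) * t) • v j := by
    intro t
    rw [Pi.smul_apply, expDiag, realDiagonal_mulVec, smul_smul, ← Real.exp_add]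
    congr 2
    ring
  simp only [hj]
  obtain ⟨h1, h2⟩ | ⟨h1, h2⟩ | ⟨h1, h2⟩ := h j
  · simp [h1, h2]
  · rw [h2, ← zero_smul ℝ (v j)]
    refine Tendsto.smul_const (Real.tendsto_exp_atBot.comp ?_) (v j)
    exact tendsto_id.const_mul_atTop_of_neg (sub_neg.2 h1)
  · simp [h1, h2]

lemma expDiag_neg (a : Fin n → ℝ) (t : ℝ) : expDiag K a (-t) = expDiag K (-a) t := by
  simp [expDiag]

/-- The group is bounded, so a moving vector may be replaced by its limit `e_i` without changing the
limit of the image. -/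
lemma tendsto_mulVec_single {γ : ℝ → Mat} (hγ : ∀ t, γ t ∈ classicalGroup K n) {i : Fin n}
    {p : ℝ → Fin n → K} {l : Fin n → K} (hp : Tendsto p atTop (𝓝 (Pi.single i 1)))
    (hq : Tendsto (fun t => γ t *ᵥ p t) atTop (𝓝 l)) :
    Tendsto (fun t => γ t *ᵥ Pi.single i 1) atTop (𝓝 l) := by
  have h0 : Tendsto (fun t => γ t *ᵥ (p t - Pi.single i 1)) atTop (𝓝 0) := by
    have hbound : Tendsto (fun t => (n : ℝ) * ‖p t - Pi.single i 1‖) atTop (𝓝 0) := by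
      simpa using ((hp.sub_const (Pi.single i 1)).norm).const_mul (n : ℝ)
    refine squeeze_zero_norm (fun t => ?_) hbound
    exact (linfty_opNorm_mulVec _ _).trans
      (mul_le_mul_of_nonneg_right (norm_le_of_mem_classicalGroup (hγ t)) (norm_nonneg _))
  simpa [mulVec_sub] using hq.sub h0

lemma flow_mulVec (a : Fin n → ℝ) {X : Mat} (hX : X ∈ classicalGroup K n) (t : ℝ)
    (u : Fin n → K) :
    flow a X t *ᵥ (expDiag K a t *ᵥ ((1 + X) *ᵥ u) + expDiag K a (-t) *ᵥ ((1 - X) *ᵥ u)) =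
      expDiag K a t *ᵥ ((1 + X) *ᵥ u) - expDiag K a (-t) *ᵥ ((1 - X) *ᵥ u) := by
  have h := congrArg (· *ᵥ u) (flow_mul a hX t)
  simpa only [growPart, decayPart, ← mulVec_mulVec, add_mulVec, sub_mulVec] using h

lemma flow_mulVec_of_mem_negEigenspace (a : Fin n → ℝ) {X : Mat} (hX : X ∈ classicalGroup K n)
    (t : ℝ) {v : Fin n → K} (hv : v ∈ negEigenspace X) :
    flow a X t *ᵥ (expDiag K a (-t) *ᵥ v) = -(expDiag K a (-t) *ᵥ v) := by
  rw [mem_negEigenspace] at hv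
  have h := flow_mulVec a hX t ((1 / 2 : ℝ) • v)
  have h1 : (1 + X) *ᵥ ((1 / 2 : ℝ) • v) = 0 := by
    rw [mulVec_smul, add_mulVec, one_mulVec, hv, add_neg_cancel, smul_zero]
  have h2 : (1 - X) *ᵥ ((1 / 2 : ℝ) • v) = v := by
    rw [mulVec_smul, sub_mulVec, one_mulVec, hv, sub_neg_eq_add, ← two_smul ℝ v, smul_smul]
    norm_num
  rwa [h1, h2, mulVec_zero, zero_add, zero_sub] at h

lemma negEigenspace_flow (a : Fin n → ℝ) {X : Mat} (hX : X ∈ classicalGroup K n) (t : ℝ) :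
    negEigenspace (flow a X t) =
      (negEigenspace X).map (mulVecRight (expDiag K a (-t))) := by
  apply le_antisymm
  · intro v hv
    rw [mem_negEigenspace] at hv
    obtain ⟨S, hS⟩ := isUnit_growPart_add_decayPart a hX t
    obtain ⟨u, hu⟩ : ∃ u, (growPart a X t + decayPart a X t) *ᵥ u = v :=
      ⟨(↑S⁻¹ : Mat) *ᵥ v, by rw [mulVec_mulVec, ← hS, S.mul_inv, one_mulVec]⟩
    have h := congrArg (· *ᵥ u) (flow_mul a hX t)
    simp only [← mulVec_mulVec] at h
    rw [hu, hv] at h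
    have hsum : (2 : ℝ) • (growPart a X t *ᵥ u) = 0 := by
      rw [two_smul]
      calc _ = (growPart a X t + decayPart a X t) *ᵥ u +
            (growPart a X t - decayPart a X t) *ᵥ u := by rw [add_mulVec, sub_mulVec]; abel
        _ = 0 := by rw [hu, ← h, add_neg_cancel]
    have hgrow : growPart a X t *ᵥ u = 0 := (smul_eq_zero.1 hsum).resolve_left two_ne_zero
    have hker : u + X *ᵥ u = 0 := by
      have := congrArg (expDiag K a (-t) *ᵥ ·) hgrow
      simpa [growPart, ← Matrix.mul_assoc, expDiag_neg_mul, add_mulVec] using this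
    have hXu : X *ᵥ u = -u := eq_neg_of_add_eq_zero_right hker
    have hu' : u ∈ negEigenspace X := hXu
    -- The preimage is `2u`: here `Pu = 0` and `(1 - X)u = 2u`, so `v = (P + N)u = exp(-tA)(2u)`.
    refine ⟨u + u, add_mem hu' hu', ?_⟩
    change expDiag K a (-t) *ᵥ (u + u) = v
    rw [← hu, add_mulVec, hgrow, zero_add, decayPart, ← mulVec_mulVec, sub_mulVec, one_mulVec,
      hXu, sub_neg_eq_add]
  · rintro _ ⟨v, hv, rfl⟩
    exact flow_mulVec_of_mem_negEigenspace a hX t hv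

lemma tendsto_flow {a : Fin n → ℝ} (ha_pos : ∀ i, 0 < a i) (ha_mono : StrictMono a) {X : Mat}
    (hX : X ∈ classicalGroup K n) :
    Tendsto (flow a X) atTop (𝓝 (signDiag K (pivots (orthCompl (negEigenspace X))))) := by
  set W := orthCompl (negEigenspace X) with hW
  have hcol : ∀ i, Tendsto (fun t => flow a X t *ᵥ Pi.single i 1) atTop
      (𝓝 (Pi.single i (if i ∈ pivots W then 1 else -1))) := by
    intro i
    split_ifs with hi
    · obtain ⟨w, hw, hwi, hwj⟩ := mem_pivots.1 hi
      rw [hW, orthCompl_negEigenspace hX] at hw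
      obtain ⟨u, hu⟩ := hw
      change (1 + X) *ᵥ u = w at hu
      have hgrow : Tendsto (fun t : ℝ => Real.exp (t * -a i) • (expDiag K a t *ᵥ w)) atTop
          (𝓝 (Pi.single i 1)) := by
        refine tendsto_exp_smul_expDiag_mulVec fun j => ?_
        obtain hj | rfl | hj := lt_trichotomy j i
        · exact Or.inr (Or.inl ⟨ha_mono hj, Pi.single_eq_of_ne hj.ne _⟩)
        · exact Or.inl ⟨rfl, by rw [hwi, Pi.single_eq_same]⟩
        · exact Or.inr (Or.inr ⟨hwj j hj, Pi.single_eq_of_ne hj.ne' _⟩)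
      -- The positivity of `a` enters here: every exponent `-a_j - a_i` is negative, whatever the
      -- vector `(1 - X)u` is.
      have hdecay : Tendsto (fun t : ℝ => Real.exp (t * -a i) •
          (expDiag K a (-t) *ᵥ ((1 - X) *ᵥ u))) atTop (𝓝 0) := by
        simp only [expDiag_neg]
        refine tendsto_exp_smul_expDiag_mulVec fun j => Or.inr (Or.inl ⟨?_, rfl⟩)
        have := ha_pos i
        have := ha_pos j
        simp only [Pi.neg_apply]
        linarith
      have hp := hgrow.add hdecay
      have hq := hgrow.sub hdecay
      rw [add_zero] at hp
      rw [sub_zero] at hq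
      refine tendsto_mulVec_single (flow_mem a hX) hp (hq.congr fun t => ?_)
      rw [← smul_add, ← smul_sub, mulVec_smul, ← hu, flow_mulVec a hX]
    · obtain ⟨v, hv, hvi, hvj⟩ := exists_mem_orthCompl_of_notMem_pivots hi
      rw [hW, orthCompl_orthCompl] at hv
      -- Under `exp(-tA)` the first nonzero coordinate dominates, so the rescaling factor is `exp(t
      -- a_i)`.
      have hp : Tendsto (fun t : ℝ => Real.exp (t * - -a i) • (expDiag K a (-t) *ᵥ v)) atTop
          (𝓝 (Pi.single i 1)) := by
        simp only [expDiag_neg]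
        refine tendsto_exp_smul_expDiag_mulVec fun j => ?_
        obtain hj | rfl | hj := lt_trichotomy j i
        · exact Or.inr (Or.inr ⟨hvj j hj, Pi.single_eq_of_ne hj.ne _⟩)
        · exact Or.inl ⟨rfl, by rw [hvi, Pi.single_eq_same]⟩
        · exact Or.inr (Or.inl ⟨neg_lt_neg (ha_mono hj), Pi.single_eq_of_ne hj.ne' _⟩)
      rw [Pi.single_neg]
      refine tendsto_mulVec_single (flow_mem a hX) hp (hp.neg.congr fun t => ?_)
      rw [mulVec_smul, flow_mulVec_of_mem_negEigenspace a hX t hv, smul_neg]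
  refine tendsto_pi_nhds.2 fun i => tendsto_pi_nhds.2 fun j => ?_
  have h := tendsto_pi_nhds.1 (hcol j) i
  simp only [mulVec_single_one, col_apply] at h
  convert h using 2
  rw [signDiag, realDiagonal]
  by_cases hij : i = j
  · subst hij
    by_cases hi : i ∈ pivots W <;> simp [hi]
  · rw [diagonal_apply_ne _ hij, Pi.single_eq_of_ne hij]

/-! ### Correspondence of cells -/

variable (K) in
lemma charZero_of_real : CharZero K :=
  charZero_of_injective_algebraMap (algebraMap ℝ K).injective

lemma signDiag_injective : Function.Injective (signDiag K : Finset (Fin n) → Mat) := by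
  intro I J h
  ext i
  have hi := congrFun (congrFun h i) i
  simp only [signDiag, realDiagonal, diagonal_apply_eq,
    (algebraMap ℝ K).injective.eq_iff] at hi
  by_cases h3 : i ∈ I <;> by_cases h4 : i ∈ J <;> simp only [h3, h4, if_true, if_false] at hi ⊢ <;>
    norm_num at hi

/-- The open cell of the critical point `signDiag I` lies over the Schubert cell of `I`. -/
lemma openCell_signDiag {a : Fin n → ℝ} (ha_pos : ∀ i, 0 < a i) (ha_mono : StrictMono a)
    (I : Finset (Fin n)) :
    openCell (realDiagonal K a) (signDiag K I) = operatorsOver (schubertCell K I) := by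
  ext X
  rw [mem_openCell_iff]
  refine and_congr_right fun hX => ?_
  rw [mem_schubertCell_iff]
  constructor
  · exact fun h => signDiag_injective (tendsto_nhds_unique (tendsto_flow ha_pos ha_mono hX) h)
  · rintro rfl
    exact tendsto_flow ha_pos ha_mono hX

/-- A critical point is a constant trajectory, so it lies in its own open cell and in that of no
other sign matrix. -/
lemma openCell_signDiag_injective (a : Fin n → ℝ) :
    Function.Injective fun I : Finset (Fin n) =>
      openCell (realDiagonal K a) (signDiag K I) := by
  intro I J h
  have hI := signDiag_mem (K := K) I
  have hflow : flow a (signDiag K I) = fun _ => signDiag K I := by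
    refine (IsGradientTrajectory.eq_flow (a := a) (γ := fun _ => signDiag K I) fun t => ?_).symm
    exact ⟨hI, 0, (signDiag_mem_criticalPoints a I).2, hasDerivAt_const t _⟩
  have hmem : signDiag K I ∈ openCell (realDiagonal K a) (signDiag K I) := by
    rw [mem_openCell_iff, hflow]
    exact ⟨hI, tendsto_const_nhds⟩
  simp only at h
  rw [h, mem_openCell_iff, hflow] at hmem
  exact signDiag_injective (tendsto_nhds_unique tendsto_const_nhds hmem.2)

lemma exp_neg_smul_realDiagonal (a : Fin n → ℝ) (t : ℝ) :
    NormedSpace.exp (-(t • realDiagonal K a)) = expDiag K a (-t) := by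
  have := charZero_of_real K
  have := finiteDimensional (K := K)
  have : CompleteSpace K := FiniteDimensional.complete ℝ K
  have hdiag : -(t • realDiagonal K a) = diagonal fun i => algebraMap ℝ K (-t * a i) := by
    ext i j
    by_cases hij : i = j <;> simp [realDiagonal, hij, Algebra.algebraMap_eq_smul_one, smul_smul]
  rw [hdiag, Matrix.exp_diagonal, expDiag, realDiagonal]
  congr 1
  ext i
  rw [Pi.coe_exp, ← NormedSpace.algebraMap_exp_comm, Real.exp_eq_exp_ℝ]

theorem height_flow_cells {a : Fin n → ℝ} (ha_pos : ∀ i, 0 < a i) (ha_mono : StrictMono a) :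
    Set.InjOn (openCell (realDiagonal K a)) (criticalPoints (realDiagonal K a)) ∧
      Set.BijOn operatorsOver (schubertCells K n) (openCells (realDiagonal K a)) ∧
      ∀ γ, IsGradientTrajectory (realDiagonal K a) γ → ∀ t : ℝ,
        negEigenspace (γ t) =
          (negEigenspace (γ 0)).map (mulVecRight (NormedSpace.exp (-(t • realDiagonal K a)))) := by
  refine ⟨?_, ⟨?_, ?_, ?_⟩, ?_⟩
  · intro X hX Y hY h
    obtain ⟨I, rfl⟩ := eq_signDiag_of_mem_criticalPoints ha_pos ha_mono.injective hX
    obtain ⟨J, rfl⟩ := eq_signDiag_of_mem_criticalPoints ha_pos ha_mono.injective hY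
    rw [openCell_signDiag_injective a h]
  · rintro _ ⟨-, -, I, -, rfl⟩
    exact ⟨_, signDiag_mem_criticalPoints a I, openCell_signDiag ha_pos ha_mono I⟩
  · rintro _ ⟨-, -, I, -, rfl⟩ _ ⟨-, -, J, -, rfl⟩ h
    rw [← openCell_signDiag ha_pos ha_mono, ← openCell_signDiag ha_pos ha_mono] at h
    rw [openCell_signDiag_injective a h]
  · rintro _ ⟨X, hX, rfl⟩
    obtain ⟨I, rfl⟩ := eq_signDiag_of_mem_criticalPoints ha_pos ha_mono.injective hX
    refine ⟨schubertCell K I, ⟨I.card, ?_, I, rfl, rfl⟩,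
      (openCell_signDiag ha_pos ha_mono I).symm⟩
    simpa using I.card_le_univ
  · intro γ hγ t
    have h := congrFun hγ.eq_flow t
    rw [h, negEigenspace_flow a (hγ 0).1, exp_neg_smul_realDiagonal]

end HeightFlow

theorem theorem2p2 (n : ℕ) (a : Fin n → ℝ) (ha_pos : ∀ i, 0 < a i) (ha_mono : StrictMono a) :
    -- the orthogonal group `O(n)`
    (Set.InjOn (HeightFlow.openCell (HeightFlow.realDiagonal ℝ a))
        (HeightFlow.criticalPoints (HeightFlow.realDiagonal ℝ a)) ∧
      Set.BijOn HeightFlow.operatorsOver (HeightFlow.schubertCells ℝ n)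
        (HeightFlow.openCells (HeightFlow.realDiagonal ℝ a)) ∧
      ∀ γ, HeightFlow.IsGradientTrajectory (HeightFlow.realDiagonal ℝ a) γ → ∀ t : ℝ,
        HeightFlow.negEigenspace (γ t) =
          (HeightFlow.negEigenspace (γ 0)).map (HeightFlow.mulVecRight
            (NormedSpace.exp (-(t • HeightFlow.realDiagonal ℝ a))))) ∧
    -- the unitary group `U(n)`
    (Set.InjOn (HeightFlow.openCell (HeightFlow.realDiagonal ℂ a))
        (HeightFlow.criticalPoints (HeightFlow.realDiagonal ℂ a)) ∧
      Set.BijOn HeightFlow.operatorsOver (HeightFlow.schubertCells ℂ n)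
        (HeightFlow.openCells (HeightFlow.realDiagonal ℂ a)) ∧
      ∀ γ, HeightFlow.IsGradientTrajectory (HeightFlow.realDiagonal ℂ a) γ → ∀ t : ℝ,
        HeightFlow.negEigenspace (γ t) =
          (HeightFlow.negEigenspace (γ 0)).map (HeightFlow.mulVecRight
            (NormedSpace.exp (-(t • HeightFlow.realDiagonal ℂ a))))) ∧
    -- the quaternionic unitary group `Sp(n)`
    (Set.InjOn (HeightFlow.openCell (HeightFlow.realDiagonal ℍ[ℝ] a))
        (HeightFlow.criticalPoints (HeightFlow.realDiagonal ℍ[ℝ] a)) ∧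
      Set.BijOn HeightFlow.operatorsOver (HeightFlow.schubertCells ℍ[ℝ] n)
        (HeightFlow.openCells (HeightFlow.realDiagonal ℍ[ℝ] a)) ∧
      ∀ γ, HeightFlow.IsGradientTrajectory (HeightFlow.realDiagonal ℍ[ℝ] a) γ → ∀ t : ℝ,
        HeightFlow.negEigenspace (γ t) =
          (HeightFlow.negEigenspace (γ 0)).map (HeightFlow.mulVecRight
            (NormedSpace.exp (-(t • HeightFlow.realDiagonal ℍ[ℝ] a))))) := by
  exact ⟨HeightFlow.height_flow_cells ha_pos ha_mono, HeightFlow.height_flow_cells ha_pos ha_mono,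
    HeightFlow.height_flow_cells ha_pos ha_mono⟩
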